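/- Let $w\ge 0$ be a function on $[0,2\pi]$ that is continuous with $w(0)=w(2\pi)$ and differentiable on $(0,2\pi)$, with $w'$ integrable, such that $d\mu(\theta)=w(\theta)\frac{d\theta}{2\pi}$ is a probability measure on the unit circle. Let $\Phi_k$ and $\varphi_k$ be the monic orthogonal and the orthonormal polynomials of $\mu$, for a polynomial $p$ of degree $k$ put $p^*(z)=z^{k}\overline{p(1/\bar z)}$, and let $\alpha_k=-\overline{\Phi_{k+1}(0)}$ be the Verblunsky coefficients, i.e. $\Phi_{k+1}(z)=z\Phi_k(z)-\bar\alpha_k\Phi_k^*(z)$. Fix $n\ge 1$ and $\beta\in\mathbb{C}$ and set $$\Phi_n(z;\beta)=z\Phi_{n-1}(z)-\bar\beta\,\Phi_{n-1}^*(z)$$ (for $|\beta|=1$ this is the paraorthogonal polynomial). For $|z|\neq 1$ define \begin{align*} G_n(z)&=i\int_0^{2\pi}\frac{|\varphi_{n-1}^*(e^{i\theta})|^2w'(\theta)}{z-e^{i\theta}}\frac{d\theta}{2\pi},\\ D_n(z)&=-iz\int_0^{2\pi}\frac{\varphi_{n-1}^*(e^{i\theta})^2w'(\theta)}{(z-e^{i\theta})e^{in\theta}}\frac{d\theta}{2\pi},\\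 J_n(z)&=i\int_0^{2\pi}\frac{\varphi_{n-1}(e^{i\theta})^2w'(\theta)}{(z-e^{i\theta})e^{i(n-2)\theta}}\frac{d\theta}{2\pi},\\ h_n(z;x;y)&=\bar x\big(n(1-\bar y\alpha_{n-1})+zG_n(z)+\bar yD_n(z)\big)-z\big(J_n(z)-\bar yG_n(z)\big), \end{align*} and let $W[f,g]=fg'-gf'$, all derivatives being taken with respect to $z$. Put \begin{align*} P(z)&=\frac{1-n}{z}-\frac{h_n'(z;\beta;\beta)}{h_n(z;\beta;\beta)},\\ Q(z)&=\frac{W[h_n(z;\beta;\beta),h_n(z;-\beta;\beta)]}{2\bar\beta z\,h_n(z;\beta;\beta)}-\frac1z\Big((n+zG_n(z))G_n(z)+J_n(z)(D_n(z)-n\alpha_{n-1})\Big), \end{align*} where for $\beta=0$ the quotient $W[h_n(z;\beta;\beta),h_n(z;-\beta;\beta)]/(2\bar\beta)$ stands for its limit as $\beta\to0$, which is $W[zJ_n(z),\,n+zG_n(z)]$. Then $y(z)=\Phi_n(z;\beta)$ satisfies $$y''(z)+P(z)y'(z)+Q(z)y(z)=0$$ at every $z\ne0$ with $|z|\neq1$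 and $h_n(z;\beta;\beta)\neq0$. Moreover, let $\Omega$ be a domain in the Riemann sphere that contains $0$ (respectively $\infty$), suppose that $h_n(\cdot;\beta;\beta)$ does not vanish identically near that point, and suppose that the germs of $P$ and $Q$ at that point extend to meromorphic functions on $\Omega$. Then the same equation, with the extended coefficients, holds on $\Omega$ at every finite point at which both extended coefficients are analytic. -/

import Mathlib

open MeasureTheory Polynomial Filter Topology

noncomputable section

namespace OPUC

/-- The measure `w(θ) dθ/2π` on the unit circle, written in the variable `θ ∈ [0, 2π)`. -/
def weightMeasure (w : ℝ → ℝ) : Measure ℝ :=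
  (volume.restrict (Set.Ico 0 (2 * Real.pi))).withDensity
    (fun θ => ENNReal.ofReal (w θ / (2 * Real.pi)))

/-- The point `e^{iθ}` of the unit circle. -/
def expi (θ : ℝ) : ℂ := Complex.exp (Complex.I * θ)

/-- The pairing `∫ p(e^{iθ}) conj (q(e^{iθ})) dμ(θ)` on polynomials. -/
def pairing (μ : Measure ℝ) (p q : ℂ[X]) : ℂ :=
  ∫ θ, p.eval (expi θ) * starRingEnd ℂ (q.eval (expi θ)) ∂μ

/-- The monic orthogonal polynomials `Φ_n(z; μ)`: Gram-Schmidt applied to `1, z, z², …`. -/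
def monicOP (μ : Measure ℝ) : ℕ → ℂ[X]
  | n => X ^ n - ∑ k : Fin n,
      C (pairing μ (X ^ n) (monicOP μ k) / pairing μ (monicOP μ k) (monicOP μ k)) * monicOP μ k
decreasing_by exact k.2

/-- The `L²(μ)` norm of `Φ_n`, that is `1 / κ_n`. -/
def normOP (μ : Measure ℝ) (n : ℕ) : ℝ :=
  Real.sqrt (∫ θ, ‖(monicOP μ n).eval (expi θ)‖ ^ 2 ∂μ)

/-- The orthonormal polynomials `φ_n = Φ_n / ‖Φ_n‖`. -/
def orthonormalOP (μ : Measure ℝ) (n : ℕ) : ℂ[X] :=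
  C (((normOP μ n)⁻¹ : ℝ) : ℂ) * monicOP μ n

/-- The reversed polynomial `p^*(z) = z^n conj (p(1 / conj z))` of a polynomial `p` of degree at
most `n`: the coefficients are conjugated and `z^k` is exchanged with `z^(n-k)`. -/
def revPoly (n : ℕ) (p : ℂ[X]) : ℂ[X] := (p.map (starRingEnd ℂ)).reflect n

/-- The Verblunsky coefficient `α_n`. It is the number in the Szegő recursion
`Φ_{n+1}(z) = z Φ_n(z) - conj α_n Φ_n^*(z)`; as `Φ_n^*(0) = 1`, it is `-conj Φ_{n+1}(0)`. -/
def verblunsky (μ : Measure ℝ) (n : ℕ) : ℂ := -starRingEnd ℂ ((monicOP μ (n + 1)).eval 0)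

/-- `Φ_n(z; β) = z Φ_{n-1}(z) - conj β Φ_{n-1}^*(z)`, for `n ≥ 1`. -/
def paraOP (μ : Measure ℝ) (n : ℕ) (β : ℂ) : ℂ[X] :=
  X * monicOP μ (n - 1) - C (starRingEnd ℂ β) * revPoly (n - 1) (monicOP μ (n - 1))

/-- The value `φ_{n-1}(e^{iθ})` for the measure with weight `w`. -/
def phiVal (w : ℝ → ℝ) (n : ℕ) (θ : ℝ) : ℂ :=
  (orthonormalOP (weightMeasure w) (n - 1)).eval (expi θ)

/-- The value `φ_{n-1}^*(e^{iθ})` for the measure with weight `w`. -/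
def phiStarVal (w : ℝ → ℝ) (n : ℕ) (θ : ℝ) : ℂ :=
  (revPoly (n - 1) (orthonormalOP (weightMeasure w) (n - 1))).eval (expi θ)

/-- `G_n(z) = i ∫ |φ_{n-1}^*(e^{iθ})|² w'(θ) / (z - e^{iθ}) dθ/2π`. -/
def G (w : ℝ → ℝ) (n : ℕ) (z : ℂ) : ℂ :=
  Complex.I * ((1 / (2 * Real.pi)) * ∫ θ in (0 : ℝ)..(2 * Real.pi),
    ((‖phiStarVal w n θ‖ ^ 2 : ℝ) : ℂ) * ((deriv w θ : ℝ) : ℂ) / (z - expi θ))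

/-- `D_n(z) = -i z ∫ φ_{n-1}^*(e^{iθ})² w'(θ) / ((z - e^{iθ}) e^{inθ}) dθ/2π`. -/
def D (w : ℝ → ℝ) (n : ℕ) (z : ℂ) : ℂ :=
  -Complex.I * z * ((1 / (2 * Real.pi)) * ∫ θ in (0 : ℝ)..(2 * Real.pi),
    phiStarVal w n θ ^ 2 * ((deriv w θ : ℝ) : ℂ) / ((z - expi θ) * expi θ ^ (n : ℤ)))

/-- `J_n(z) = i ∫ φ_{n-1}(e^{iθ})² w'(θ) / ((z - e^{iθ}) e^{i(n-2)θ}) dθ/2π`. -/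
def J (w : ℝ → ℝ) (n : ℕ) (z : ℂ) : ℂ :=
  Complex.I * ((1 / (2 * Real.pi)) * ∫ θ in (0 : ℝ)..(2 * Real.pi),
    phiVal w n θ ^ 2 * ((deriv w θ : ℝ) : ℂ) / ((z - expi θ) * expi θ ^ ((n : ℤ) - 2)))

/-- `n (1 - conj y α_{n-1}) + z G_n(z) + conj y D_n(z)`, the first bracket in `h_n(z; x; y)`. -/
def hFst (w : ℝ → ℝ) (n : ℕ) (y z : ℂ) : ℂ :=
  n * (1 - starRingEnd ℂ y * verblunsky (weightMeasure w) (n - 1)) + z * G w n z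
    + starRingEnd ℂ y * D w n z

/-- `z (J_n(z) - conj y G_n(z))`, the second term in `h_n(z; x; y)`. -/
def hSnd (w : ℝ → ℝ) (n : ℕ) (y z : ℂ) : ℂ :=
  z * (J w n z - starRingEnd ℂ y * G w n z)

/-- `h_n(z; x; y)`, with the variable `z` last. -/
def h (w : ℝ → ℝ) (n : ℕ) (x y z : ℂ) : ℂ :=
  starRingEnd ℂ x * hFst w n y z - hSnd w n y z

/-- The Wronskian `W[f, g] = f g' - g f'`. -/
def wronskian (f g : ℂ → ℂ) (z : ℂ) : ℂ := f z * deriv g z - g z * deriv f z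

/-- For `b ≠ 0` the factor `conj b` cancels from `W[h_n(z; b; y), h_n(z; -b; y)] / (2 conj b)`;
the right-hand side makes sense, and depends continuously on `b = y`, at `0` as well. -/
theorem wronskian_h_div (w : ℝ → ℝ) (n : ℕ) (b y z : ℂ) (hb : b ≠ 0)
    (h1 : DifferentiableAt ℂ (hFst w n y) z) (h2 : DifferentiableAt ℂ (hSnd w n y) z) :
    wronskian (h w n b y) (h w n (-b) y) z / (2 * starRingEnd ℂ b)
      = wronskian (hSnd w n y) (hFst w n y) z := by
  have hb' : starRingEnd ℂ b ≠ 0 := by simpa using hb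
  have key : ∀ x : ℂ, deriv (h w n x y) z
      = starRingEnd ℂ x * deriv (hFst w n y) z - deriv (hSnd w n y) z := fun x =>
    (((h1.hasDerivAt).const_mul (starRingEnd ℂ x)).sub h2.hasDerivAt).deriv
  rw [div_eq_iff (by simpa using hb)]
  simp only [wronskian, key, h, map_neg]
  ring

/-- The quotient `W[h_n(z; β; β), h_n(z; -β; β)] / (2 conj β)`. At `β = 0` both sides of the
fraction vanish identically, and the quotient means its continuous extension in `β`, which is
`W[z J_n(z), n + z G_n(z)]`, see `wronskian_h_div`. -/
def wronskianQuotient (w : ℝ → ℝ) (n : ℕ) (β z : ℂ) : ℂ :=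
  if β = 0 then wronskian (fun s => s * J w n s) (fun s => n + s * G w n s) z
  else wronskian (h w n β β) (h w n (-β) β) z / (2 * starRingEnd ℂ β)

/-- The coefficient of `y'` in the differential equation. -/
def coeffOne (w : ℝ → ℝ) (n : ℕ) (β z : ℂ) : ℂ :=
  (1 - n) / z - deriv (h w n β β) z / h w n β β z

/-- The coefficient of `y` in the differential equation. -/
def coeffZero (w : ℝ → ℝ) (n : ℕ) (β z : ℂ) : ℂ :=
  wronskianQuotient w n β z / (z * h w n β β z)
    - 1 / z * ((n + z * G w n z) * G w n z
      + J w n z * (D w n z - n * verblunsky (weightMeasure w) (n - 1)))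

/-- `U` is a domain (of the Riemann sphere, with the point `∞` removed if it is there) that
contains zero and `l` is the filter of punctured neighbourhoods of zero, or `U` contains a
neighbourhood of infinity and `l` is the filter of punctured neighbourhoods of infinity. -/
def IsDomainAt (U : Set ℂ) (l : Filter ℂ) : Prop :=
  IsOpen U ∧ IsConnected U ∧
    ((0 ∈ U ∧ l = 𝓝[≠] (0 : ℂ)) ∨ (U ∈ Bornology.cobounded ℂ ∧ l = Bornology.cobounded ℂ))

end OPUC

end

/-!
With `N = n - 1`, the Christoffel–Darboux kernel
`S_z(ζ) = (Φ_N^*(z) ζ Φ_N(ζ) - z Φ_N(z) Φ_N^*(ζ)) / (ζ - z)` reproduces polynomials `p` of degree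
at most `N`: `∫ p(ζ) S_z(ζ) ζ^{-N} dμ = ‖Φ_N‖² p(z)`. Integrating the derivatives of
`Φ_N S_z ζ^{-N}` and `Φ_N^* S_z ζ^{-N-1}` by parts throws them onto the weight, and the resulting
Cauchy integrals of `w'` turn the reproducing identity into the first-order system
`z Φ_N' = (N + z G_n) Φ_N - J_n Φ_N^*`, `(Φ_N^*)' = (n α_N - D_n) Φ_N - G_n Φ_N^*`.
Rewritten for the pair `y = Φ_n(·; β)`, `Φ_N^*`, the first row becomes `z y' = F y + h_n Φ_N^*`,
where `F` is the first bracket of `h_n`, and the system has trace `n / z`. Solving this row for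
`Φ_N^*` where `h_n ≠ 0` gives the second-order equation, and the identity theorem for meromorphic
functions continues it.
-/

noncomputable section

namespace OPUC

section Calculus

theorem absolutelyContinuousOnInterval_of_integrableOn_deriv {f : ℝ → ℝ} {a b : ℝ} (hab : a ≤ b)
    (hcont : ContinuousOn f (Set.Icc a b)) (hdiff : ∀ x ∈ Set.Ioo a b, DifferentiableAt ℝ f x)
    (hint : IntegrableOn (deriv f) (Set.Ioo a b)) : AbsolutelyContinuousOnInterval f a b := by
  have hint' : IntervalIntegrable (deriv f) volume a b :=
    (intervalIntegrable_iff_integrableOn_Ioo_of_le hab).2 hint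
  have hftc : ∀ x ∈ Set.uIcc a b, f x = f a + ∫ t in a..x, deriv f t := by
    intro x hx
    rw [Set.uIcc_of_le hab] at hx
    rw [intervalIntegral.integral_eq_sub_of_hasDerivAt_of_le hx.1
      (hcont.mono (Set.Icc_subset_Icc_right hx.2))
      (fun t ht => (hdiff t ⟨ht.1, ht.2.trans_le hx.2⟩).hasDerivAt)
      (hint'.mono_set (Set.uIcc_subset_uIcc_left (Set.uIcc_of_le hab ▸ hx)))]
    ring
  have hprimitive : AbsolutelyContinuousOnInterval (fun x => f a + ∫ t in a..x, deriv f t) a b :=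
    (contDiffOn_const.absolutelyContinuousOnInterval).fun_add
      (hint'.absolutelyContinuousOnInterval_intervalIntegral Set.left_mem_uIcc)
  rw [absolutelyContinuousOnInterval_iff] at hprimitive ⊢
  intro ε hε
  obtain ⟨δ, hδ, h⟩ := hprimitive ε hε
  refine ⟨δ, hδ, fun E hE hlen => ?_⟩
  convert h E hE hlen using 3 with i hi
  · exact hftc _ (hE.1 i hi).1
  · exact hftc _ (hE.1 i hi).2

theorem integral_deriv_smul_eq_sub_of_absolutelyContinuousOnInterval {E : Type*}
    [NormedAddCommGroup E] [NormedSpace ℝ E] [CompleteSpace E] {f : ℝ → ℝ} {g g' : ℝ → E}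
    {a b : ℝ} (hf : AbsolutelyContinuousOnInterval f a b) (hg : ∀ x, HasDerivAt g (g' x) x)
    (hg' : Continuous g') :
    ∫ x in a..b, deriv f x • g x = f b • g b - f a • g a - ∫ x in a..b, f x • g' x := by
  have hgcont : Continuous g := continuous_iff_continuousAt.2 fun x => (hg x).continuousAt
  have hfg : IntervalIntegrable (fun x => deriv f x • g x) volume a b :=
    hf.intervalIntegrable_deriv.smul_continuousOn hgcont.continuousOn
  have hfg' : IntervalIntegrable (fun x => f x • g' x) volume a b :=
    (hf.continuousOn.smul hg'.continuousOn).intervalIntegrable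
  refine (SeparatingDual.eq_iff_forall_dual_eq (R := ℝ)).2 fun L => ?_
  have hL : ∀ x, HasDerivAt (fun t => L (g t)) (L (g' x)) x := fun x =>
    L.hasFDerivAt.comp_hasDerivAt x (hg x)
  have hderiv : deriv (fun t => L (g t)) = fun t => L (g' t) := funext fun x => (hL x).deriv
  have hLg : AbsolutelyContinuousOnInterval (fun t => L (g t)) a b := by
    refine ContDiffOn.absolutelyContinuousOnInterval (ContDiff.contDiffOn ?_)
    rw [contDiff_one_iff_deriv, hderiv]
    exact ⟨fun x => (hL x).differentiableAt, L.continuous.comp hg'⟩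
  have hparts := hLg.integral_mul_deriv_eq_deriv_mul hf
  simp only [hderiv] at hparts
  rw [map_sub, map_sub, ← L.intervalIntegral_comp_comm hfg, ← L.intervalIntegral_comp_comm hfg']
  simpa only [map_smul, smul_eq_mul, mul_comm] using hparts

theorem differentiableAt_integral_div_sub {α : Type*} [MeasurableSpace α] {ν : Measure α}
    {f e : α → ℂ} (hf : Integrable f ν) (he : AEStronglyMeasurable e ν) {z : ℂ} {ε : ℝ}
    (hε : 0 < ε) (hz : ∀ x, ε ≤ ‖z - e x‖) :
    DifferentiableAt ℂ (fun s => ∫ x, f x / (s - e x) ∂ν) z := by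
  have hball : Metric.ball z (ε / 2) ∈ 𝓝 z := Metric.ball_mem_nhds z (half_pos hε)
  have hdist : ∀ x, ∀ s ∈ Metric.ball z (ε / 2), ε / 2 ≤ ‖s - e x‖ := by
    intro x s hs
    rw [Metric.mem_ball, dist_comm, dist_eq_norm] at hs
    linarith [hz x, norm_sub_le_norm_sub_add_norm_sub z s (e x)]
  have hmeas : ∀ s, AEStronglyMeasurable (fun x => s - e x) ν := fun s =>
    aestronglyMeasurable_const.sub he
  refine (hasDerivAt_integral_of_dominated_loc_of_deriv_le hball
    (F' := fun s x => -f x / (s - e x) ^ 2) (bound := fun x => ‖f x‖ / (ε / 2) ^ 2)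
    (Eventually.of_forall fun s => hf.1.div₀ (hmeas s)) ?_
    (hf.1.neg.div₀ ((hmeas z).pow 2)) ?_ (hf.norm.div_const _) ?_).2.differentiableAt
  · refine (hf.norm.div_const ε).mono' (hf.1.div₀ (hmeas z)) (Eventually.of_forall fun x => ?_)
    rw [Pi.div_apply, norm_div]
    gcongr
    exact hz x
  · refine Eventually.of_forall fun x s hs => ?_
    rw [norm_div, norm_neg, norm_pow]
    gcongr
    exact hdist x s hs
  · refine Eventually.of_forall fun x s hs => ?_
    have hne : s - e x ≠ 0 := norm_pos_iff.1 ((half_pos hε).trans_le (hdist x s hs))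
    simpa using (hasDerivAt_const s (f x)).fun_div ((hasDerivAt_id s).sub_const (e x)) hne

theorem eq_zero_of_meromorphicOn_of_eventuallyEq_zero {𝕜 E : Type*} [NontriviallyNormedField 𝕜]
    [NormedAddCommGroup E] [NormedSpace 𝕜 E] {f : 𝕜 → E} {U : Set 𝕜} (hU : IsPreconnected U)
    (hf : MeromorphicOn f U) {z₀ z : 𝕜} (hz₀ : z₀ ∈ U) (h0 : f =ᶠ[𝓝[≠] z₀] 0) (hz : z ∈ U)
    (hc : ContinuousAt f z) : f z = 0 := by
  have htop : meromorphicOrderAt f z = ⊤ := by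
    by_contra hne
    exact hf.meromorphicOrderAt_ne_top_of_isPreconnected hU hz hz₀ hne
      (meromorphicOrderAt_eq_top_iff.2 h0)
  exact tendsto_nhds_unique_of_eventuallyEq (hc.tendsto.mono_left nhdsWithin_le_nhds)
    tendsto_const_nhds (meromorphicOrderAt_eq_top_iff.1 htop)

theorem second_deriv_eq_of_first_order_system {𝕜 : Type*} [NontriviallyNormedField 𝕜]
    {y y₁ u a b : 𝕜 → 𝕜} {y₂ a' b' c d z : 𝕜} (hy : HasDerivAt y (y₁ z) z)
    (hy₁ : HasDerivAt y₁ y₂ z) (hu : HasDerivAt u (c * y z + d * u z) z)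
    (hsys : y₁ =ᶠ[𝓝 z] fun s => a s * y s + b s * u s) (ha : HasDerivAt a a' z)
    (hb : HasDerivAt b b' z) (hbz : b z ≠ 0) :
    y₂ = (a z + d + b' / b z) * y₁ z
      - (a z * d - b z * c - a' + a z * (b' / b z)) * y z := by
  have hy₂ : y₂ = a' * y z + a z * y₁ z + (b' * u z + b z * (c * y z + d * u z)) :=
    hy₁.unique (((ha.mul hy).add (hb.mul hu)).congr_of_eventuallyEq hsys)
  have huz : u z = (y₁ z - a z * y z) / b z := by
    rw [eq_div_iff hbz]
    linear_combination -hsys.eq_of_nhds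
  rw [hy₂, huz]
  field_simp
  ring

end Calculus

section Circle

theorem norm_expi (θ : ℝ) : ‖expi θ‖ = 1 := by
  rw [expi, mul_comm, Complex.norm_exp_ofReal_mul_I]

theorem expi_ne_zero (θ : ℝ) : expi θ ≠ 0 := Complex.exp_ne_zero _

theorem conj_expi (θ : ℝ) : starRingEnd ℂ (expi θ) = (expi θ)⁻¹ :=
  (Complex.inv_eq_conj (norm_expi θ)).symm

theorem hasDerivAt_expi (θ : ℝ) : HasDerivAt expi (Complex.I * expi θ) θ := by
  have h : HasDerivAt (fun t : ℝ => Complex.I * (t : ℂ)) Complex.I θ := by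
    simpa using (Complex.ofRealCLM.hasDerivAt (x := θ)).const_mul Complex.I
  exact h.cexp.congr_deriv (mul_comm _ _)

theorem continuous_expi : Continuous expi := by
  unfold expi
  fun_prop

theorem expi_two_pi : expi (2 * Real.pi) = expi 0 := by
  simp [expi, mul_comm Complex.I, Complex.exp_two_pi_mul_I]

theorem abs_norm_sub_one_le_norm_sub_expi (z : ℂ) (θ : ℝ) : |‖z‖ - 1| ≤ ‖z - expi θ‖ := by
  simpa only [norm_expi] using abs_norm_sub_norm_le z (expi θ)

theorem sub_expi_ne_zero {z : ℂ} (hz : ‖z‖ ≠ 1) (θ : ℝ) : z - expi θ ≠ 0 := by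
  rintro h
  exact hz (by rw [sub_eq_zero.1 h, norm_expi])

theorem countable_preimage_expi {s : Set ℂ} (hs : s.Countable) : (expi ⁻¹' s).Countable :=
  hs.preimage_cexp.preimage
    ((mul_right_injective₀ Complex.I_ne_zero).comp Complex.ofReal_injective)

theorem exists_norm_eval_expi_le (p : ℂ[X]) : ∃ B : ℝ, ∀ θ, ‖p.eval (expi θ)‖ ≤ B := by
  obtain ⟨B, hB⟩ := (isCompact_sphere (0 : ℂ) 1).exists_bound_of_continuousOn
    p.continuous.continuousOn
  exact ⟨B, fun θ => hB _ (by simp [norm_expi])⟩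

/-- The Laurent polynomial `z⁻ᵐ p(z)` on the unit circle, as a function of the angle. -/
def laurentVal (m : ℕ) (p : ℂ[X]) (θ : ℝ) : ℂ := p.eval (expi θ) * (expi θ ^ m)⁻¹

theorem laurentVal_add (m : ℕ) (p q : ℂ[X]) (θ : ℝ) :
    laurentVal m (p + q) θ = laurentVal m p θ + laurentVal m q θ := by
  rw [laurentVal, eval_add, add_mul, laurentVal, laurentVal]

theorem laurentVal_C_mul (m : ℕ) (a : ℂ) (p : ℂ[X]) (θ : ℝ) :
    laurentVal m (C a * p) θ = a * laurentVal m p θ := by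
  rw [laurentVal, eval_mul, eval_C, mul_assoc, laurentVal]

theorem laurentVal_succ_X_mul (m : ℕ) (p : ℂ[X]) (θ : ℝ) :
    laurentVal (m + 1) (X * p) θ = laurentVal m p θ := by
  have := expi_ne_zero θ
  simp only [laurentVal, eval_mul, eval_X]
  field_simp
  ring

theorem continuous_laurentVal (m : ℕ) (p : ℂ[X]) : Continuous (laurentVal m p) :=
  (p.continuous.comp continuous_expi).mul
    ((continuous_expi.pow m).inv₀ fun θ => pow_ne_zero _ (expi_ne_zero θ))

theorem laurentVal_two_pi (m : ℕ) (p : ℂ[X]) : laurentVal m p (2 * Real.pi) = laurentVal m p 0 := by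
  rw [laurentVal, expi_two_pi, laurentVal]

theorem integrable_laurentVal (μ : Measure ℝ) [IsFiniteMeasure μ] (m : ℕ) (p : ℂ[X]) :
    Integrable (laurentVal m p) μ := by
  obtain ⟨B, hB⟩ := exists_norm_eval_expi_le p
  refine Integrable.of_bound (continuous_laurentVal m p).aestronglyMeasurable B
    (Eventually.of_forall fun θ => ?_)
  simpa [laurentVal, norm_expi] using hB θ

theorem hasDerivAt_laurentVal (m : ℕ) (p : ℂ[X]) (θ : ℝ) :
    HasDerivAt (laurentVal m p)
      (Complex.I * laurentVal m (X * derivative p - C (m : ℂ) * p) θ) θ := by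
  have h0 := expi_ne_zero θ
  have hnum : HasDerivAt (fun t => p.eval (expi t))
      ((derivative p).eval (expi θ) * (Complex.I * expi θ)) θ :=
    (p.hasDerivAt (expi θ)).comp θ (hasDerivAt_expi θ)
  have hden := ((hasDerivAt_expi θ).fun_pow m).fun_inv (pow_ne_zero m h0)
  refine (hnum.fun_mul hden).congr_deriv ?_
  simp only [laurentVal, eval_sub, eval_mul, eval_X, eval_C]
  cases m with
  | zero => simp; ring
  | succ m => push_cast; field_simp; ring

end Circle

section Moment

/-- The integral of the Laurent polynomial `z⁻ᵐ p(z)` against a measure on the unit circle. -/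
def moment (μ : Measure ℝ) (m : ℕ) (p : ℂ[X]) : ℂ := ∫ θ, laurentVal m p θ ∂μ

theorem moment_succ_X_mul (μ : Measure ℝ) (m : ℕ) (p : ℂ[X]) :
    moment μ (m + 1) (X * p) = moment μ m p := by
  simp only [moment, laurentVal_succ_X_mul]

theorem moment_C_mul (μ : Measure ℝ) (m : ℕ) (a : ℂ) (p : ℂ[X]) :
    moment μ m (C a * p) = a * moment μ m p := by
  simp only [moment, laurentVal_C_mul, integral_const_mul]

variable (μ : Measure ℝ) [IsFiniteMeasure μ]

theorem moment_add (m : ℕ) (p q : ℂ[X]) : moment μ m (p + q) = moment μ m p + moment μ m q := by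
  simp only [moment, laurentVal_add]
  exact integral_add (integrable_laurentVal μ m p) (integrable_laurentVal μ m q)

theorem moment_sub (m : ℕ) (p q : ℂ[X]) : moment μ m (p - q) = moment μ m p - moment μ m q := by
  rw [eq_sub_iff_add_eq, ← moment_add, sub_add_cancel]

end Moment

section RevPoly

theorem natDegree_revPoly_le {N : ℕ} {p : ℂ[X]} (hp : p.natDegree ≤ N) :
    (revPoly N p).natDegree ≤ N :=
  natDegree_reflect_le.trans (max_le le_rfl (natDegree_map_le.trans hp))

theorem coeff_revPoly {N k : ℕ} (hk : k ≤ N) (p : ℂ[X]) :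
    (revPoly N p).coeff k = starRingEnd ℂ (p.coeff (N - k)) := by
  rw [revPoly, coeff_reflect, revAt_le hk, coeff_map]

theorem revPoly_revPoly (N : ℕ) (p : ℂ[X]) : revPoly N (revPoly N p) = p := by
  ext k
  simp [revPoly, coeff_reflect]

theorem revPoly_C_mul (N : ℕ) (a : ℂ) (p : ℂ[X]) :
    revPoly N (C a * p) = C (starRingEnd ℂ a) * revPoly N p := by
  simp [revPoly, reflect_C_mul]

theorem revPoly_X_mul {N : ℕ} {p : ℂ[X]} (hp : p.natDegree ≤ N) :
    revPoly (N + 1) (X * p) = revPoly N p := by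
  rw [revPoly, Polynomial.map_mul, map_X, add_comm,
    reflect_mul _ _ natDegree_X_le (natDegree_map_le.trans hp), reflect_one_X, one_mul, revPoly]

theorem eval_revPoly {N : ℕ} {p : ℂ[X]} (hp : p.natDegree ≤ N) {z : ℂ} (hz : z ≠ 0) :
    (revPoly N p).eval z = z ^ N * starRingEnd ℂ (p.eval (starRingEnd ℂ z)⁻¹) := by
  let _ : Invertible z⁻¹ := invertibleOfNonzero (inv_ne_zero hz)
  have h := eval₂_reflect_mul_pow (RingHom.id ℂ) z⁻¹ N (p.map (starRingEnd ℂ))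
    (natDegree_map_le.trans hp)
  have hconj : z⁻¹ = starRingEnd ℂ (starRingEnd ℂ z)⁻¹ := by simp
  rw [invOf_eq_inv, inv_inv, eval₂_id, eval₂_id, inv_pow] at h
  rw [revPoly, ← eval₂_at_apply, ← eval_map, ← hconj, ← h, mul_left_comm,
    mul_inv_cancel₀ (pow_ne_zero _ hz), mul_one]

theorem eval_expi_revPoly {N : ℕ} {p : ℂ[X]} (hp : p.natDegree ≤ N) (θ : ℝ) :
    (revPoly N p).eval (expi θ) = expi θ ^ N * starRingEnd ℂ (p.eval (expi θ)) := by
  rw [eval_revPoly hp (expi_ne_zero θ), conj_expi, inv_inv]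

theorem conj_eval_expi_revPoly {N : ℕ} {p : ℂ[X]} (hp : p.natDegree ≤ N) (θ : ℝ) :
    starRingEnd ℂ ((revPoly N p).eval (expi θ)) = laurentVal N p θ := by
  rw [eval_expi_revPoly hp, map_mul, map_pow, conj_expi, Complex.conj_conj, inv_pow, mul_comm,
    laurentVal]

end RevPoly

section Pairing

theorem pairing_eq_moment (μ : Measure ℝ) {N : ℕ} (p : ℂ[X]) {q : ℂ[X]} (hq : q.natDegree ≤ N) :
    pairing μ p q = moment μ N (p * revPoly N q) := by
  refine integral_congr_ae (Eventually.of_forall fun θ => ?_)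
  have := expi_ne_zero θ
  simp only [laurentVal, eval_mul, eval_expi_revPoly hq]
  field_simp

theorem pairing_revPoly (μ : Measure ℝ) {N : ℕ} (p : ℂ[X]) {q : ℂ[X]} (hq : q.natDegree ≤ N) :
    pairing μ p (revPoly N q) = moment μ N (p * q) := by
  rw [pairing_eq_moment μ p (natDegree_revPoly_le hq), revPoly_revPoly]

theorem conj_pairing (μ : Measure ℝ) (p q : ℂ[X]) :
    starRingEnd ℂ (pairing μ p q) = pairing μ q p := by
  rw [pairing, ← integral_conj]
  simp [pairing, mul_comm]

theorem pairing_C_mul_left (μ : Measure ℝ) (a : ℂ) (p r : ℂ[X]) :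
    pairing μ (C a * p) r = a * pairing μ p r := by
  simp only [pairing_eq_moment μ _ le_rfl, mul_assoc, moment_C_mul]

theorem pairing_X_mul_X_mul (μ : Measure ℝ) (p q : ℂ[X]) :
    pairing μ (X * p) (X * q) = pairing μ p q := by
  refine integral_congr_ae (Eventually.of_forall fun θ => ?_)
  have := expi_ne_zero θ
  simp only [eval_mul, eval_X, map_mul, conj_expi]
  field_simp

theorem pairing_self (μ : Measure ℝ) (p : ℂ[X]) :
    pairing μ p p = ((∫ θ, ‖p.eval (expi θ)‖ ^ 2 ∂μ : ℝ) : ℂ) := by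
  rw [pairing, ← integral_complex_ofReal]
  refine integral_congr_ae (Eventually.of_forall fun θ => ?_)
  simp [Complex.mul_conj, Complex.normSq_eq_norm_sq]

variable (μ : Measure ℝ) [IsFiniteMeasure μ]

theorem pairing_add_left (p q r : ℂ[X]) :
    pairing μ (p + q) r = pairing μ p r + pairing μ q r := by
  simp only [pairing_eq_moment μ _ le_rfl, add_mul, moment_add]

theorem pairing_sub_left (p q r : ℂ[X]) :
    pairing μ (p - q) r = pairing μ p r - pairing μ q r := by
  simp only [pairing_eq_moment μ _ le_rfl, sub_mul, moment_sub]

theorem pairing_sum_left {ι : Type*} (s : Finset ι) (f : ι → ℂ[X]) (r : ℂ[X]) :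
    pairing μ (∑ i ∈ s, f i) r = ∑ i ∈ s, pairing μ (f i) r := by
  induction s using Finset.cons_induction with
  | empty => simp [pairing]
  | cons i s hi ih => rw [Finset.sum_cons, Finset.sum_cons, pairing_add_left, ih]

end Pairing

section OrthogonalPolynomials

theorem natDegree_X_mul_le (p : ℂ[X]) : (X * p).natDegree ≤ p.natDegree + 1 :=
  (natDegree_mul_le_of_le natDegree_X_le le_rfl).trans_eq (add_comm _ _)

theorem isMonicOfDegree_monicOP (μ : Measure ℝ) (n : ℕ) : IsMonicOfDegree (monicOP μ n) n := by
  induction n using Nat.strong_induction_on with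
  | _ n ih =>
    have hsum : (∑ k : Fin n, C (pairing μ (X ^ n) (monicOP μ k) /
        pairing μ (monicOP μ k) (monicOP μ k)) * monicOP μ k).degree < (X ^ n : ℂ[X]).degree := by
      rw [degree_X_pow]
      refine (degree_sum_le _ _).trans_lt ((Finset.sup_lt_iff (WithBot.bot_lt_coe n)).2 ?_)
      intro k _
      rw [← smul_eq_C_mul]
      refine (degree_smul_le _ _).trans_lt ?_
      rw [degree_eq_natDegree (ih k k.2).ne_zero, (ih k k.2).natDegree_eq]
      exact Nat.cast_lt.2 k.2
    rw [monicOP]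
    refine ⟨natDegree_eq_of_degree_eq_some ?_, (monic_X_pow n).sub_of_left hsum⟩
    rw [degree_sub_eq_left_of_degree_lt hsum, degree_X_pow]

theorem natDegree_monicOP_le (μ : Measure ℝ) (n : ℕ) : (monicOP μ n).natDegree ≤ n :=
  (isMonicOfDegree_monicOP μ n).natDegree_eq.le

theorem pairing_monicOP_self (μ : Measure ℝ) (n : ℕ) :
    pairing μ (monicOP μ n) (monicOP μ n) = (normOP μ n : ℂ) ^ 2 := by
  rw [pairing_self, normOP, ← Complex.ofReal_pow,
    Real.sq_sqrt (integral_nonneg fun θ => by positivity)]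

/-- The reversed monic orthogonal polynomials `Φ_n^*`. -/
def reversedOP (μ : Measure ℝ) (n : ℕ) : ℂ[X] := revPoly n (monicOP μ n)

theorem natDegree_reversedOP_le (μ : Measure ℝ) (n : ℕ) : (reversedOP μ n).natDegree ≤ n :=
  natDegree_revPoly_le (natDegree_monicOP_le μ n)

theorem coeff_zero_reversedOP (μ : Measure ℝ) (n : ℕ) : (reversedOP μ n).coeff 0 = 1 := by
  have hΦ : (monicOP μ n).coeff n = 1 :=
    ((isMonicOfDegree_iff _ n).1 (isMonicOfDegree_monicOP μ n)).2
  rw [reversedOP, coeff_revPoly n.zero_le, Nat.sub_zero, hΦ, map_one]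

/-- A measure with infinite support on the unit circle, in the form in which it is used: no nonzero
polynomial vanishes almost everywhere. -/
def NontrivialMeasure (μ : Measure ℝ) : Prop := ∀ p : ℂ[X], p ≠ 0 → pairing μ p p ≠ 0

theorem nontrivialMeasure_of_nullSingletonClass {μ : Measure ℝ} [IsFiniteMeasure μ]
    [NullSingletonClass μ] (hμ : μ ≠ 0) : NontrivialMeasure μ := by
  intro p hp h0
  obtain ⟨B, hB⟩ := exists_norm_eval_expi_le p
  have hint : Integrable (fun θ => ‖p.eval (expi θ)‖ ^ 2) μ := by
    refine Integrable.of_bound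
      (((p.continuous.comp continuous_expi).norm.pow 2).aestronglyMeasurable) (B ^ 2)
      (Eventually.of_forall fun θ => ?_)
    rw [norm_pow, norm_norm]
    exact pow_le_pow_left₀ (norm_nonneg _) (hB θ) 2
  rw [pairing_self, Complex.ofReal_eq_zero,
    integral_eq_zero_iff_of_nonneg (fun θ => by positivity) hint] at h0
  have hroots : (expi ⁻¹' {z | p.IsRoot z}).Countable :=
    countable_preimage_expi (finite_setOfPred_isRoot hp).countable
  refine hμ (ae_eq_bot.1 (eventually_false_iff_eq_bot.1 ?_))
  filter_upwards [h0, hroots.ae_notMem μ] with θ hzero hne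
  exact hne (by simpa using hzero)

variable {μ : Measure ℝ} {n : ℕ}

theorem normOP_ne_zero (hμ : NontrivialMeasure μ) (n : ℕ) : (normOP μ n : ℂ) ≠ 0 := by
  have h := hμ _ (isMonicOfDegree_monicOP μ n).ne_zero
  rwa [pairing_monicOP_self, ne_eq, sq_eq_zero_iff] at h

variable [IsFiniteMeasure μ]

theorem pairing_monicOP_of_lt (hμ : NontrivialMeasure μ) :
    ∀ k < n, pairing μ (monicOP μ n) (monicOP μ k) = 0 := by
  induction n using Nat.strong_induction_on with
  | _ n ih =>
    intro k hk
    rw [monicOP, pairing_sub_left, pairing_sum_left, Finset.sum_eq_single ⟨k, hk⟩,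
      pairing_C_mul_left, div_mul_cancel₀ _ (hμ _ (isMonicOfDegree_monicOP μ k).ne_zero), sub_self]
    · intro j _ hj
      have hjk : (j : ℕ) ≠ k := fun h => hj (Fin.ext h)
      rw [pairing_C_mul_left]
      rcases lt_or_gt_of_ne hjk with h | h
      · rw [← conj_pairing μ (monicOP μ k), ih k hk j h, map_zero, mul_zero]
      · rw [ih j j.2 k h, mul_zero]
    · simp

theorem degree_sub_coeff_mul_monicOP_lt (μ : Measure ℝ) {q : ℂ[X]} (hq : q.natDegree ≤ n) :
    (q - C (q.coeff n) * monicOP μ n).degree < n := by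
  rw [degree_lt_iff_coeff_zero]
  intro k hk
  obtain ⟨hdeg, hcoeff⟩ := (isMonicOfDegree_iff _ n).1 (isMonicOfDegree_monicOP μ n)
  rcases hk.eq_or_lt with rfl | hk
  · simp [hcoeff]
  · simp [coeff_eq_zero_of_natDegree_lt (hq.trans_lt hk),
      coeff_eq_zero_of_natDegree_lt (hdeg.trans_lt hk)]

theorem pairing_monicOP_of_degree_lt (hμ : NontrivialMeasure μ) {q : ℂ[X]} (hq : q.degree < n) :
    pairing μ q (monicOP μ n) = 0 := by
  suffices key : ∀ m ≤ n, ∀ q : ℂ[X], q.degree < m → pairing μ q (monicOP μ n) = 0 from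
    key n le_rfl q hq
  intro m
  induction m with
  | zero =>
    intro _ q hq
    simp [degree_eq_bot.1 (Nat.WithBot.lt_zero_iff.1 hq), pairing]
  | succ m ih =>
    intro hm q hq
    have hq' : q.natDegree ≤ m :=
      natDegree_le_iff_coeff_eq_zero.2 ((degree_lt_iff_coeff_zero q (m + 1)).1 hq)
    have h := ih (by omega) _ (degree_sub_coeff_mul_monicOP_lt μ hq')
    rw [pairing_sub_left, pairing_C_mul_left, ← conj_pairing μ (monicOP μ n) (monicOP μ m),
      pairing_monicOP_of_lt hμ m hm, map_zero, mul_zero, sub_zero] at h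
    exact h

theorem pairing_monicOP (hμ : NontrivialMeasure μ) {q : ℂ[X]} (hq : q.natDegree ≤ n) :
    pairing μ q (monicOP μ n) = q.coeff n * (normOP μ n : ℂ) ^ 2 := by
  have h := pairing_monicOP_of_degree_lt hμ (degree_sub_coeff_mul_monicOP_lt μ hq)
  rwa [pairing_sub_left, pairing_C_mul_left, sub_eq_zero, pairing_monicOP_self] at h

theorem moment_mul_reversedOP (hμ : NontrivialMeasure μ) {s : ℂ[X]} (hs : s.natDegree ≤ n) :
    moment μ n (s * reversedOP μ n) = s.coeff n * (normOP μ n : ℂ) ^ 2 := by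
  rw [reversedOP, ← pairing_eq_moment μ s (natDegree_monicOP_le μ n), pairing_monicOP hμ hs]

theorem moment_mul_monicOP (hμ : NontrivialMeasure μ) {s : ℂ[X]} (hs : s.natDegree ≤ n) :
    moment μ n (s * monicOP μ n) = s.coeff 0 * (normOP μ n : ℂ) ^ 2 := by
  rw [mul_comm, ← pairing_revPoly μ _ hs, ← conj_pairing,
    pairing_monicOP hμ (natDegree_revPoly_le hs), coeff_revPoly le_rfl]
  simp

theorem moment_succ_mul_reversedOP (hμ : NontrivialMeasure μ) {s : ℂ[X]}
    (hs : s.natDegree ≤ n + 1) : moment μ (n + 1) (s * reversedOP μ n)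
      = s.coeff (n + 1) * (normOP μ n : ℂ) ^ 2
        + s.coeff 0 * moment μ (n + 1) (reversedOP μ n) := by
  have hdivX : s.divX.natDegree ≤ n := by
    rw [natDegree_divX_eq_natDegree_tsub_one]
    omega
  conv_lhs => rw [← X_mul_divX_add s, add_mul, mul_assoc]
  rw [moment_add, moment_succ_X_mul, moment_C_mul, moment_mul_reversedOP hμ hdivX, coeff_divX]

theorem natDegree_monicOP_succ_sub_X_mul_le (μ : Measure ℝ) (n : ℕ) :
    (monicOP μ (n + 1) - X * monicOP μ n).natDegree ≤ n := by
  have hX : IsMonicOfDegree (X * monicOP μ n) (n + 1) := by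
    rw [add_comm n]
    exact (isMonicOfDegree_X ℂ).mul (isMonicOfDegree_monicOP μ n)
  exact Nat.lt_succ_iff.1
    ((isMonicOfDegree_monicOP μ (n + 1)).natDegree_sub_lt n.succ_ne_zero hX)

theorem pairing_X_mul_monicOP_reversedOP (hμ : NontrivialMeasure μ) (n : ℕ) :
    pairing μ (X * monicOP μ n) (reversedOP μ n)
      = -(monicOP μ (n + 1)).eval 0 * (normOP μ n : ℂ) ^ 2 := by
  have hdiff : pairing μ (monicOP μ (n + 1) - X * monicOP μ n) (reversedOP μ n)
      = (monicOP μ (n + 1)).eval 0 * (normOP μ n : ℂ) ^ 2 := by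
    rw [reversedOP, pairing_revPoly μ _ (natDegree_monicOP_le μ n),
      moment_mul_monicOP hμ (natDegree_monicOP_succ_sub_X_mul_le μ n)]
    simp [coeff_zero_eq_eval_zero]
  have horth : pairing μ (monicOP μ (n + 1)) (reversedOP μ n) = 0 := by
    rw [← conj_pairing, pairing_monicOP hμ ((natDegree_reversedOP_le μ n).trans n.le_succ),
      coeff_eq_zero_of_natDegree_lt (Nat.lt_succ_of_le (natDegree_reversedOP_le μ n))]
    simp
  rw [pairing_sub_left, horth] at hdiff
  linear_combination -hdiff

theorem moment_succ_reversedOP (hμ : NontrivialMeasure μ) (n : ℕ) :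
    moment μ (n + 1) (reversedOP μ n) = verblunsky μ n * (normOP μ n : ℂ) ^ 2 := by
  have hX : (X * monicOP μ n).natDegree ≤ n + 1 :=
    (natDegree_X_mul_le _).trans (Nat.succ_le_succ (natDegree_monicOP_le μ n))
  have hconj := congrArg (starRingEnd ℂ) (pairing_X_mul_monicOP_reversedOP hμ n)
  have hΨ := natDegree_reversedOP_le μ n
  rw [conj_pairing, pairing_eq_moment μ _ hX, revPoly_X_mul (natDegree_monicOP_le μ n),
    ← reversedOP, moment_succ_mul_reversedOP hμ (hΨ.trans n.le_succ), coeff_zero_reversedOP,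
    coeff_eq_zero_of_natDegree_lt (Nat.lt_succ_of_le hΨ), zero_mul, zero_add, one_mul] at hconj
  rw [hconj, verblunsky]
  simp

end OrthogonalPolynomials

section Zeros

variable {μ : Measure ℝ} [IsFiniteMeasure μ] {n : ℕ} {z : ℂ}

theorem norm_lt_one_of_isRoot_monicOP (hμ : NontrivialMeasure μ) (hz : (monicOP μ n).IsRoot z) :
    ‖z‖ < 1 := by
  obtain ⟨r, hr⟩ := dvd_iff_isRoot.2 hz
  have hΦ := isMonicOfDegree_monicOP μ n
  have hr0 : r ≠ 0 := right_ne_zero_of_mul (hr ▸ hΦ.ne_zero)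
  have hdeg : n = 1 + r.natDegree := by
    rw [← hΦ.natDegree_eq, hr, natDegree_mul (X_sub_C_ne_zero z) hr0, natDegree_X_sub_C]
  have hlead : r.leadingCoeff = 1 := by
    simpa [hr] using hΦ.leadingCoeff_eq
  have hX : X * r = monicOP μ n + C z * r := by
    rw [hr]
    ring
  have horth : pairing μ (monicOP μ n) r = 0 := by
    rw [← conj_pairing, pairing_monicOP hμ (by omega), coeff_eq_zero_of_natDegree_lt (by omega)]
    simp
  have hXr : pairing μ (monicOP μ n) (X * r) = (normOP μ n : ℂ) ^ 2 := by
    rw [← conj_pairing, pairing_monicOP hμ ((natDegree_X_mul_le r).trans (by omega)), hdeg,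
      add_comm 1, coeff_X_mul, ← leadingCoeff, hlead]
    simp
  have hrX : pairing μ r (X * r) = starRingEnd ℂ z * pairing μ r r := by
    rw [← conj_pairing, hX, pairing_add_left, horth, pairing_C_mul_left, zero_add, map_mul,
      conj_pairing]
  -- Multiplication by the variable is isometric and `X r = Φ_n + z r` is an orthogonal sum.
  have hpyth : pairing μ r r = (normOP μ n : ℂ) ^ 2 + (‖z‖ ^ 2 : ℝ) * pairing μ r r := by
    conv_lhs => rw [← pairing_X_mul_X_mul]
    conv_lhs => enter [2]; rw [hX]
    rw [pairing_add_left, pairing_C_mul_left, hXr, hrX, ← mul_assoc, Complex.mul_conj,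
      Complex.normSq_eq_norm_sq]
  rw [pairing_self] at hpyth
  norm_cast at hpyth
  have hnorm : 0 < normOP μ n ^ 2 := by
    have h := normOP_ne_zero hμ n
    norm_cast at h
    positivity
  have hnonneg : 0 ≤ ∫ θ, ‖r.eval (expi θ)‖ ^ 2 ∂μ := integral_nonneg fun θ => by positivity
  by_contra! hle
  linarith [le_mul_of_one_le_left hnonneg (one_le_pow₀ hle (n := 2))]

theorem eval_reversedOP_ne_zero (hμ : NontrivialMeasure μ) (hz : ‖z‖ ≤ 1) :
    (reversedOP μ n).eval z ≠ 0 := by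
  rcases eq_or_ne z 0 with rfl | hz0
  · rw [← coeff_zero_eq_eval_zero, coeff_zero_reversedOP]
    exact one_ne_zero
  · rw [reversedOP, eval_revPoly (natDegree_monicOP_le μ n) hz0]
    refine mul_ne_zero (pow_ne_zero _ hz0) fun h => ?_
    have hlt := norm_lt_one_of_isRoot_monicOP hμ ((map_eq_zero _).1 h)
    rw [norm_inv, RCLike.norm_conj, inv_lt_one₀ (norm_pos_iff.2 hz0)] at hlt
    exact hlt.not_ge hz

end Zeros

section ChristoffelDarboux

theorem natDegree_X_mul_derivative_le (p : ℂ[X]) :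
    (X * derivative p).natDegree ≤ p.natDegree := by
  rcases eq_or_ne p.natDegree 0 with h0 | h0
  · simp [derivative_of_natDegree_zero h0]
  · have h1 := natDegree_X_mul_le (derivative p)
    have h2 := natDegree_derivative_lt h0
    omega

theorem natDegree_X_mul_divByMonic_X_sub_C_le (p : ℂ[X]) (z : ℂ) :
    (X * (p /ₘ (X - C z))).natDegree ≤ p.natDegree := by
  rcases eq_or_ne p.natDegree 0 with h0 | h0
  · rw [(divByMonic_eq_zero_iff (monic_X_sub_C z)).2, mul_zero, natDegree_zero]
    · exact Nat.zero_le _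
    · rw [degree_X_sub_C]
      exact (natDegree_eq_zero_iff_degree_le_zero.1 h0).trans_lt zero_lt_one
  · have h1 := natDegree_X_mul_le (p /ₘ (X - C z))
    rw [natDegree_divByMonic _ (monic_X_sub_C z), natDegree_X_sub_C] at h1
    omega

/-- The polynomial `ζ ↦ (Φ_N^*(z) ζ Φ_N(ζ) - z Φ_N(z) Φ_N^*(ζ)) / (ζ - z)`. Up to normalization,
its product with `ζ^{-N}` is the reproducing kernel of the polynomials of degree at most `N`. -/
def cdPoly (μ : Measure ℝ) (N : ℕ) (z : ℂ) : ℂ[X] :=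
  (C ((reversedOP μ N).eval z) * (X * monicOP μ N)
    - C (z * (monicOP μ N).eval z) * reversedOP μ N) /ₘ (X - C z)

theorem X_sub_C_mul_cdPoly (μ : Measure ℝ) (N : ℕ) (z : ℂ) :
    (X - C z) * cdPoly μ N z = C ((reversedOP μ N).eval z) * (X * monicOP μ N)
      - C (z * (monicOP μ N).eval z) * reversedOP μ N := by
  refine mul_divByMonic_eq_iff_isRoot.2 ?_
  simp only [IsRoot, eval_sub, eval_mul, eval_C, eval_X]
  ring

theorem natDegree_cdPoly_le (μ : Measure ℝ) (N : ℕ) (z : ℂ) : (cdPoly μ N z).natDegree ≤ N := by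
  rw [cdPoly, natDegree_divByMonic _ (monic_X_sub_C z), natDegree_X_sub_C, Nat.sub_le_iff_le_add]
  refine (natDegree_sub_le _ _).trans (max_le ?_ ?_)
  · exact (natDegree_C_mul_le _ _).trans ((natDegree_X_mul_le _).trans
      (Nat.succ_le_succ (natDegree_monicOP_le μ N)))
  · exact (natDegree_C_mul_le _ _).trans ((natDegree_reversedOP_le μ N).trans N.le_succ)

theorem coeff_zero_cdPoly (μ : Measure ℝ) (N : ℕ) (z : ℂ) :
    (cdPoly μ N z).coeff 0 = (monicOP μ N).eval z := by
  have h := X_sub_C_mul_cdPoly μ N z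
  rcases eq_or_ne z 0 with rfl | hz
  · rw [← coeff_zero_eq_eval_zero (reversedOP μ N), coeff_zero_reversedOP, C_1, one_mul, zero_mul,
      C_0, zero_mul, sub_zero, sub_zero] at h
    rw [mul_left_cancel₀ X_ne_zero h, coeff_zero_eq_eval_zero]
  · have h0 := congrArg (fun p : ℂ[X] => p.coeff 0) h
    simp only [mul_coeff_zero, coeff_sub, coeff_X_zero, coeff_C_zero, coeff_zero_reversedOP] at h0
    refine mul_left_cancel₀ (neg_ne_zero.2 hz) ?_
    linear_combination h0

theorem coeff_cdPoly (μ : Measure ℝ) (N : ℕ) (z : ℂ) :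
    (cdPoly μ N z).coeff N = (reversedOP μ N).eval z := by
  have h := congrArg (fun p : ℂ[X] => p.coeff (N + 1)) (X_sub_C_mul_cdPoly μ N z)
  have hΦ : (monicOP μ N).coeff N = 1 :=
    ((isMonicOfDegree_iff _ N).1 (isMonicOfDegree_monicOP μ N)).2
  simpa only [sub_mul, coeff_sub, coeff_X_mul, coeff_C_mul, hΦ, mul_one, mul_zero, sub_zero,
    coeff_eq_zero_of_natDegree_lt (Nat.lt_succ_of_le (natDegree_cdPoly_le μ N z)),
    coeff_eq_zero_of_natDegree_lt (Nat.lt_succ_of_le (natDegree_reversedOP_le μ N))] using h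

variable {μ : Measure ℝ} [IsFiniteMeasure μ] {N : ℕ} {p : ℂ[X]}

theorem moment_mul_cdPoly_eq_eval_mul_moment (hμ : NontrivialMeasure μ) (hp : p.natDegree ≤ N)
    (z : ℂ) : moment μ N (p * cdPoly μ N z) = p.eval z * moment μ N (cdPoly μ N z) := by
  obtain ⟨r, hr⟩ : ∃ r, r = p /ₘ (X - C z) := ⟨_, rfl⟩
  have hXr : (X * r).natDegree ≤ N := hr ▸ (natDegree_X_mul_divByMonic_X_sub_C_le p z).trans hp
  have hrN : r.coeff N = 0 := by
    rw [← coeff_X_mul, coeff_eq_zero_of_natDegree_lt (Nat.lt_succ_of_le hXr)]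
  have hrdeg : r.natDegree ≤ N := by
    rw [hr, natDegree_divByMonic _ (monic_X_sub_C z)]
    exact (Nat.sub_le _ _).trans hp
  have hdiv : C (p.eval z) + (X - C z) * r = p := by
    rw [hr, ← modByMonic_X_sub_C_eq_C_eval, modByMonic_add_div]
  have hdecomp : p * cdPoly μ N z = C (p.eval z) * cdPoly μ N z
      + (C ((reversedOP μ N).eval z) * ((X * r) * monicOP μ N)
        - C (z * (monicOP μ N).eval z) * (r * reversedOP μ N)) := by
    linear_combination -cdPoly μ N z * hdiv + r * X_sub_C_mul_cdPoly μ N z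
  rw [hdecomp, moment_add, moment_sub, moment_C_mul, moment_C_mul, moment_C_mul,
    moment_mul_monicOP hμ hXr, moment_mul_reversedOP hμ hrdeg, hrN]
  simp

theorem moment_cdPoly (hμ : NontrivialMeasure μ) (z : ℂ) :
    moment μ N (cdPoly μ N z) = (normOP μ N : ℂ) ^ 2 := by
  have hS := natDegree_cdPoly_le μ N z
  by_cases hΦ : (monicOP μ N).eval z = 0
  · have hΨ := eval_reversedOP_ne_zero (n := N) hμ (norm_lt_one_of_isRoot_monicOP hμ hΦ).le
    have h := moment_mul_cdPoly_eq_eval_mul_moment hμ (natDegree_reversedOP_le μ N) z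
    rw [mul_comm, moment_mul_reversedOP hμ hS, coeff_cdPoly] at h
    exact (mul_left_cancel₀ hΨ h).symm
  · have h := moment_mul_cdPoly_eq_eval_mul_moment hμ (natDegree_monicOP_le μ N) z
    rw [mul_comm, moment_mul_monicOP hμ hS, coeff_zero_cdPoly] at h
    exact (mul_left_cancel₀ hΦ h).symm

theorem moment_mul_cdPoly (hμ : NontrivialMeasure μ) (hp : p.natDegree ≤ N) (z : ℂ) :
    moment μ N (p * cdPoly μ N z) = p.eval z * (normOP μ N : ℂ) ^ 2 := by
  rw [moment_mul_cdPoly_eq_eval_mul_moment hμ hp, moment_cdPoly hμ]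

theorem moment_derivative_monicOP_mul_cdPoly (hμ : NontrivialMeasure μ) (N : ℕ) (z : ℂ) :
    moment μ N (X * derivative (monicOP μ N * cdPoly μ N z)
        - C (N : ℂ) * (monicOP μ N * cdPoly μ N z))
      = (z * (derivative (monicOP μ N)).eval z - N * (monicOP μ N).eval z)
        * (normOP μ N : ℂ) ^ 2 := by
  have hΦ := natDegree_monicOP_le μ N
  have hdeg : (X * derivative (monicOP μ N) - C (N : ℂ) * monicOP μ N).natDegree ≤ N :=
    (natDegree_sub_le _ _).trans (max_le ((natDegree_X_mul_derivative_le _).trans hΦ)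
      ((natDegree_C_mul_le _ _).trans hΦ))
  have hsplit : X * derivative (monicOP μ N * cdPoly μ N z)
        - C (N : ℂ) * (monicOP μ N * cdPoly μ N z)
      = (X * derivative (monicOP μ N) - C (N : ℂ) * monicOP μ N) * cdPoly μ N z
        + (X * derivative (cdPoly μ N z)) * monicOP μ N := by
    rw [derivative_mul]
    ring
  rw [hsplit, moment_add, moment_mul_cdPoly hμ hdeg, moment_mul_monicOP hμ
    ((natDegree_X_mul_derivative_le _).trans (natDegree_cdPoly_le μ N z))]
  simp

theorem moment_derivative_reversedOP_mul_cdPoly (hμ : NontrivialMeasure μ) (N : ℕ) (z : ℂ) :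
    moment μ (N + 1) (X * derivative (reversedOP μ N * cdPoly μ N z)
        - C ((N + 1 : ℕ) : ℂ) * (reversedOP μ N * cdPoly μ N z))
      = ((derivative (reversedOP μ N)).eval z
          - (N + 1 : ℕ) * verblunsky μ N * (monicOP μ N).eval z) * (normOP μ N : ℂ) ^ 2 := by
  have hS := natDegree_cdPoly_le μ N z
  have hΨ' : (derivative (reversedOP μ N)).natDegree ≤ N :=
    (natDegree_derivative_le _).trans ((Nat.sub_le _ _).trans (natDegree_reversedOP_le μ N))
  have hS' : (derivative (cdPoly μ N z)).natDegree ≤ N :=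
    (natDegree_derivative_le _).trans ((Nat.sub_le _ _).trans hS)
  have hsplit : X * derivative (reversedOP μ N * cdPoly μ N z)
        - C ((N + 1 : ℕ) : ℂ) * (reversedOP μ N * cdPoly μ N z)
      = X * (derivative (reversedOP μ N) * cdPoly μ N z)
        + X * (derivative (cdPoly μ N z) * reversedOP μ N)
        - C ((N + 1 : ℕ) : ℂ) * (cdPoly μ N z * reversedOP μ N) := by
    rw [derivative_mul]
    ring
  have hSN : (cdPoly μ N z).coeff (N + 1) = 0 :=
    coeff_eq_zero_of_natDegree_lt (Nat.lt_succ_of_le hS)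
  rw [hsplit, moment_sub, moment_add, moment_C_mul, moment_succ_X_mul, moment_succ_X_mul,
    moment_mul_cdPoly hμ hΨ', moment_mul_reversedOP hμ hS', coeff_derivative, hSN,
    moment_succ_mul_reversedOP hμ (hS.trans N.le_succ), hSN, coeff_zero_cdPoly,
    moment_succ_reversedOP hμ]
  ring

end ChristoffelDarboux

section Weight

/-- A nonzero periodic absolutely continuous weight on `[0, 2π]`. The measure it induces need not
be normalized. -/
structure IsWeight (w : ℝ → ℝ) : Prop where
  absolutelyContinuous : AbsolutelyContinuousOnInterval w 0 (2 * Real.pi)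
  periodic : w 0 = w (2 * Real.pi)
  nonneg : ∀ θ ∈ Set.Icc 0 (2 * Real.pi), 0 ≤ w θ
  weightMeasure_ne_zero : weightMeasure w ≠ 0

namespace IsWeight

variable {w : ℝ → ℝ} (hw : IsWeight w)

include hw

theorem continuousOn : ContinuousOn w (Set.Icc 0 (2 * Real.pi)) := by
  simpa only [Set.uIcc_of_le Real.two_pi_pos.le] using hw.absolutelyContinuous.continuousOn

theorem intervalIntegrable_deriv :
    IntervalIntegrable (fun θ => ((deriv w θ : ℝ) : ℂ)) volume 0 (2 * Real.pi) :=
  hw.absolutelyContinuous.intervalIntegrable_deriv.imp Integrable.ofReal Integrable.ofReal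

theorem integral_weightMeasure (f : ℝ → ℂ) : ∫ θ, f θ ∂(weightMeasure w)
    = (1 / (2 * Real.pi)) * ∫ θ in (0 : ℝ)..(2 * Real.pi), f θ * (w θ : ℂ) := by
  have hmeas : AEMeasurable w (volume.restrict (Set.Ico 0 (2 * Real.pi))) :=
    (hw.continuousOn.mono Set.Ico_subset_Icc_self).aemeasurable measurableSet_Ico
  rw [weightMeasure, integral_withDensity_eq_integral_toReal_smul₀
      (hmeas.div_const _).ennreal_ofReal (Eventually.of_forall fun θ => ENNReal.ofReal_lt_top),
    intervalIntegral.integral_of_le Real.two_pi_pos.le, ← integral_Ico_eq_integral_Ioc,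
    ← integral_const_mul]
  refine setIntegral_congr_fun measurableSet_Ico fun θ hθ => ?_
  have hnonneg : 0 ≤ w θ / (2 * Real.pi) :=
    div_nonneg (hw.nonneg θ (Set.Ico_subset_Icc_self hθ)) Real.two_pi_pos.le
  simp only [ENNReal.toReal_ofReal hnonneg, Complex.real_smul]
  push_cast
  ring

theorem isFiniteMeasure_weightMeasure : IsFiniteMeasure (weightMeasure w) :=
  isFiniteMeasure_withDensity_ofReal
    (((hw.continuousOn.integrableOn_Icc.mono_set Set.Ico_subset_Icc_self).div_const _).2)

theorem nontrivialMeasure : NontrivialMeasure (weightMeasure w) :=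
  have := hw.isFiniteMeasure_weightMeasure
  have : NullSingletonClass (weightMeasure w) := by
    unfold weightMeasure
    infer_instance
  nontrivialMeasure_of_nullSingletonClass hw.weightMeasure_ne_zero

theorem integral_laurentVal_mul_deriv (m : ℕ) (p : ℂ[X]) :
    Complex.I * ((1 / (2 * Real.pi)) * ∫ θ in (0 : ℝ)..(2 * Real.pi),
        laurentVal m p θ * ((deriv w θ : ℝ) : ℂ))
      = moment (weightMeasure w) m (X * derivative p - C (m : ℂ) * p) := by
  have hparts := integral_deriv_smul_eq_sub_of_absolutelyContinuousOnInterval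
    hw.absolutelyContinuous (hasDerivAt_laurentVal m p)
    (continuous_const.mul (continuous_laurentVal m (X * derivative p - C (m : ℂ) * p)))
  rw [laurentVal_two_pi, ← hw.periodic, sub_self, zero_sub] at hparts
  simp only [Complex.real_smul, mul_left_comm _ Complex.I, intervalIntegral.integral_const_mul]
    at hparts
  simp only [mul_comm (laurentVal _ _ _)]
  rw [hparts, moment, hw.integral_weightMeasure]
  simp only [mul_comm (laurentVal _ _ _)]
  linear_combination -((1 / (2 * Real.pi)) * ∫ θ in (0 : ℝ)..(2 * Real.pi),
    (w θ : ℂ) * laurentVal m (X * derivative p - C (m : ℂ) * p) θ) * Complex.I_mul_I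

end IsWeight

end Weight

section CauchyTransform

/-- The Cauchy transform `i ∫ p(e^{iθ}) e^{-imθ} w'(θ) / (z - e^{iθ}) dθ/2π`, of which `G_n`, `D_n`
and `J_n` are instances. -/
def cauchyTransform (w : ℝ → ℝ) (m : ℕ) (p : ℂ[X]) (z : ℂ) : ℂ :=
  Complex.I * ((1 / (2 * Real.pi)) * ∫ θ in (0 : ℝ)..(2 * Real.pi),
    laurentVal m p θ * ((deriv w θ : ℝ) : ℂ) / (z - expi θ))

theorem cauchyTransform_succ_X_mul (w : ℝ → ℝ) (m : ℕ) (p : ℂ[X]) (z : ℂ) :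
    cauchyTransform w (m + 1) (X * p) z = cauchyTransform w m p z := by
  simp only [cauchyTransform, laurentVal_succ_X_mul]

theorem cauchyTransform_C_mul (w : ℝ → ℝ) (m : ℕ) (a : ℂ) (p : ℂ[X]) (z : ℂ) :
    cauchyTransform w m (C a * p) z = a * cauchyTransform w m p z := by
  simp only [cauchyTransform, laurentVal_C_mul, mul_assoc, mul_div_assoc,
    intervalIntegral.integral_const_mul]
  ring

variable {w : ℝ → ℝ} (hw : IsWeight w) (m : ℕ) (p q : ℂ[X]) {z : ℂ} (hz : ‖z‖ ≠ 1)

include hw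

theorem intervalIntegrable_laurentVal_mul_deriv :
    IntervalIntegrable (fun θ => laurentVal m p θ * ((deriv w θ : ℝ) : ℂ)) volume
      0 (2 * Real.pi) :=
  hw.intervalIntegrable_deriv.continuousOn_mul (continuous_laurentVal m p).continuousOn

include hz

theorem differentiableAt_cauchyTransform : DifferentiableAt ℂ (cauchyTransform w m p) z := by
  have hint := (intervalIntegrable_laurentVal_mul_deriv hw m p).1
  have hdiff := differentiableAt_integral_div_sub hint continuous_expi.aestronglyMeasurable
    (abs_pos.2 (sub_ne_zero.2 hz)) (abs_norm_sub_one_le_norm_sub_expi z)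
  simp only [← intervalIntegral.integral_of_le Real.two_pi_pos.le] at hdiff
  exact (hdiff.const_mul _).const_mul _

theorem cauchyTransform_sub : cauchyTransform w m (p - q) z
    = cauchyTransform w m p z - cauchyTransform w m q z := by
  have hint : ∀ r : ℂ[X], IntervalIntegrable (fun θ => laurentVal m r θ
      * ((deriv w θ : ℝ) : ℂ) / (z - expi θ)) volume 0 (2 * Real.pi) := fun r => by
    simp only [div_eq_mul_inv]
    exact (intervalIntegrable_laurentVal_mul_deriv hw m r).mul_continuousOn
      ((continuous_const.sub continuous_expi).inv₀ (sub_expi_ne_zero hz)).continuousOn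
  simp only [cauchyTransform, laurentVal, eval_sub, sub_mul, sub_div] at hint ⊢
  rw [intervalIntegral.integral_sub (hint p) (hint q), mul_sub, mul_sub]

theorem cauchyTransform_C_sub_X_mul : cauchyTransform w m ((C z - X) * p) z
    = moment (weightMeasure w) m (X * derivative p - C (m : ℂ) * p) := by
  rw [← hw.integral_laurentVal_mul_deriv, cauchyTransform]
  congr 4
  funext θ
  have := sub_expi_ne_zero hz θ
  simp only [laurentVal, eval_mul, eval_sub, eval_X, eval_C]
  field_simp

end CauchyTransform

section FirstOrderSystem

theorem phiVal_succ (w : ℝ → ℝ) (N : ℕ) (θ : ℝ) : phiVal w (N + 1) θ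
    = (normOP (weightMeasure w) N : ℂ)⁻¹ * (monicOP (weightMeasure w) N).eval (expi θ) := by
  simp [phiVal, orthonormalOP]

theorem phiStarVal_succ (w : ℝ → ℝ) (N : ℕ) (θ : ℝ) : phiStarVal w (N + 1) θ
    = (normOP (weightMeasure w) N : ℂ)⁻¹ * (reversedOP (weightMeasure w) N).eval (expi θ) := by
  rw [phiStarVal, orthonormalOP, Nat.add_sub_cancel, revPoly_C_mul, Complex.conj_ofReal, eval_mul,
    eval_C, Complex.ofReal_inv, reversedOP]

theorem const_mul_cauchyTransform {w : ℝ → ℝ} {m : ℕ} {p : ℂ[X]} {a z : ℂ} {F : ℝ → ℂ}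
    (hF : ∀ θ, F θ = a * (laurentVal m p θ * ((deriv w θ : ℝ) : ℂ) / (z - expi θ))) :
    Complex.I * ((1 / (2 * Real.pi)) * ∫ θ in (0 : ℝ)..(2 * Real.pi), F θ)
      = a * cauchyTransform w m p z := by
  simp only [hF, intervalIntegral.integral_const_mul, cauchyTransform]
  ring

theorem G_succ (w : ℝ → ℝ) (N : ℕ) (z : ℂ) :
    G w (N + 1) z = ((normOP (weightMeasure w) N : ℂ) ^ 2)⁻¹ * cauchyTransform w N
      (monicOP (weightMeasure w) N * reversedOP (weightMeasure w) N) z := by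
  refine const_mul_cauchyTransform fun θ => ?_
  rw [← Complex.normSq_eq_norm_sq, ← Complex.mul_conj, phiStarVal_succ, map_mul, map_inv₀,
    Complex.conj_ofReal, reversedOP, conj_eval_expi_revPoly (natDegree_monicOP_le _ N), laurentVal,
    laurentVal, eval_mul]
  ring

theorem D_succ (w : ℝ → ℝ) (N : ℕ) (z : ℂ) :
    D w (N + 1) z = -z * (((normOP (weightMeasure w) N : ℂ) ^ 2)⁻¹ * cauchyTransform w (N + 1)
      (reversedOP (weightMeasure w) N ^ 2) z) := by
  rw [D, neg_mul_comm, mul_right_comm, mul_comm]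
  congr 1
  refine const_mul_cauchyTransform fun θ => ?_
  rw [zpow_natCast, phiStarVal_succ, laurentVal, eval_pow, mul_comm (z - expi θ), div_eq_mul_inv,
    mul_inv]
  ring

theorem J_succ (w : ℝ → ℝ) (N : ℕ) (z : ℂ) :
    J w (N + 1) z = ((normOP (weightMeasure w) N : ℂ) ^ 2)⁻¹ * cauchyTransform w N
      (X * monicOP (weightMeasure w) N ^ 2) z := by
  refine const_mul_cauchyTransform fun θ => ?_
  have hpow : expi θ ^ (((N + 1 : ℕ) : ℤ) - 2) = expi θ ^ N * (expi θ)⁻¹ := by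
    rw [← zpow_natCast, ← zpow_neg_one, ← zpow_add₀ (expi_ne_zero θ)]
    congr 1
    push_cast
    ring
  rw [hpow, phiVal_succ, laurentVal, eval_mul, eval_pow, eval_X, mul_comm (expi θ ^ N),
    div_eq_mul_inv, mul_inv, mul_inv, inv_inv]
  ring

variable {w : ℝ → ℝ} (hw : IsWeight w) (N : ℕ) {z : ℂ} (hz : ‖z‖ ≠ 1)

include hw hz

theorem differentiableAt_G : DifferentiableAt ℂ (G w (N + 1)) z := by
  rw [funext (G_succ w N)]
  exact (differentiableAt_cauchyTransform hw _ _ hz).const_mul _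

theorem differentiableAt_D : DifferentiableAt ℂ (D w (N + 1)) z := by
  rw [funext (D_succ w N)]
  exact differentiableAt_id.neg.mul ((differentiableAt_cauchyTransform hw _ _ hz).const_mul _)

theorem differentiableAt_J : DifferentiableAt ℂ (J w (N + 1)) z := by
  rw [funext (J_succ w N)]
  exact (differentiableAt_cauchyTransform hw _ _ hz).const_mul _

theorem mul_eval_derivative_monicOP :
    z * (derivative (monicOP (weightMeasure w) N)).eval z
      = (N + z * G w (N + 1) z) * (monicOP (weightMeasure w) N).eval z
        - J w (N + 1) z * (reversedOP (weightMeasure w) N).eval z := by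
  have := hw.isFiniteMeasure_weightMeasure
  have hν := normOP_ne_zero hw.nontrivialMeasure N
  have hS := X_sub_C_mul_cdPoly (weightMeasure w) N z
  have hparts := moment_derivative_monicOP_mul_cdPoly hw.nontrivialMeasure N z
  rw [G_succ, J_succ]
  set Φ := monicOP (weightMeasure w) N
  set Ψ := reversedOP (weightMeasure w) N
  have hnumerator : (C z - X) * (Φ * cdPoly (weightMeasure w) N z)
      = C (z * Φ.eval z) * (Φ * Ψ) - C (Ψ.eval z) * (X * Φ ^ 2) := by
    linear_combination -Φ * hS
  rw [← cauchyTransform_C_sub_X_mul hw _ _ hz, hnumerator, cauchyTransform_sub hw _ _ _ hz,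
    cauchyTransform_C_mul, cauchyTransform_C_mul] at hparts
  field_simp
  linear_combination -hparts

theorem eval_derivative_reversedOP :
    (derivative (reversedOP (weightMeasure w) N)).eval z
      = ((N + 1 : ℕ) * verblunsky (weightMeasure w) N - D w (N + 1) z)
          * (monicOP (weightMeasure w) N).eval z
        - G w (N + 1) z * (reversedOP (weightMeasure w) N).eval z := by
  have := hw.isFiniteMeasure_weightMeasure
  have hν := normOP_ne_zero hw.nontrivialMeasure N
  have hS := X_sub_C_mul_cdPoly (weightMeasure w) N z
  have hparts := moment_derivative_reversedOP_mul_cdPoly hw.nontrivialMeasure N z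
  rw [G_succ, D_succ]
  set Φ := monicOP (weightMeasure w) N
  set Ψ := reversedOP (weightMeasure w) N
  have hnumerator : (C z - X) * (Ψ * cdPoly (weightMeasure w) N z)
      = C (z * Φ.eval z) * Ψ ^ 2 - C (Ψ.eval z) * (X * (Φ * Ψ)) := by
    linear_combination -Ψ * hS
  rw [← cauchyTransform_C_sub_X_mul hw _ _ hz, hnumerator, cauchyTransform_sub hw _ _ _ hz,
    cauchyTransform_C_mul, cauchyTransform_C_mul, cauchyTransform_succ_X_mul] at hparts
  field_simp
  linear_combination -hparts

end FirstOrderSystem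

section SecondOrderEquation

theorem paraOP_succ (μ : Measure ℝ) (N : ℕ) (β : ℂ) : paraOP μ (N + 1) β
    = X * monicOP μ N - C (starRingEnd ℂ β) * reversedOP μ N := rfl

theorem mul_eval_monicOP (μ : Measure ℝ) (N : ℕ) (β z : ℂ) : z * (monicOP μ N).eval z
    = (paraOP μ (N + 1) β).eval z + starRingEnd ℂ β * (reversedOP μ N).eval z := by
  simp [paraOP_succ]

theorem det_firstOrderSystem (w : ℝ → ℝ) (N : ℕ) (β z : ℂ) :
    hFst w (N + 1) β z
        * (starRingEnd ℂ β * ((N + 1 : ℕ) * verblunsky (weightMeasure w) N - D w (N + 1) z)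
          - z * G w (N + 1) z)
      - ((N + 1 : ℕ) * verblunsky (weightMeasure w) N - D w (N + 1) z) * h w (N + 1) β β z
      = -z * (((N + 1 : ℕ) + z * G w (N + 1) z) * G w (N + 1) z
        + J w (N + 1) z * (D w (N + 1) z - (N + 1 : ℕ) * verblunsky (weightMeasure w) N)) := by
  rw [h, hSnd, hFst, Nat.add_sub_cancel]
  ring

variable {w : ℝ → ℝ} (hw : IsWeight w) (N : ℕ) (β : ℂ) {z : ℂ} (hz : ‖z‖ ≠ 1)

include hw hz

theorem differentiableAt_hFst : DifferentiableAt ℂ (hFst w (N + 1) β) z :=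
  ((differentiableAt_const _).add (differentiableAt_id.mul (differentiableAt_G hw N hz))).add
    ((differentiableAt_D hw N hz).const_mul _)

theorem differentiableAt_hSnd : DifferentiableAt ℂ (hSnd w (N + 1) β) z :=
  differentiableAt_id.mul
    ((differentiableAt_J hw N hz).sub ((differentiableAt_G hw N hz).const_mul _))

theorem hasDerivAt_h (x : ℂ) : HasDerivAt (h w (N + 1) x β)
    (starRingEnd ℂ x * deriv (hFst w (N + 1) β) z - deriv (hSnd w (N + 1) β) z) z :=
  ((differentiableAt_hFst hw N β hz).hasDerivAt.const_mul _).sub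
    (differentiableAt_hSnd hw N β hz).hasDerivAt

theorem wronskianQuotient_eq_wronskian : wronskianQuotient w (N + 1) β z
    = wronskian (hSnd w (N + 1) β) (hFst w (N + 1) β) z := by
  by_cases hβ : β = 0
  · have hfst : hFst w (N + 1) β = fun s => ((N + 1 : ℕ) : ℂ) + s * G w (N + 1) s := by
      funext s
      simp [hFst, hβ]
    have hsnd : hSnd w (N + 1) β = fun s => s * J w (N + 1) s := by
      funext s
      simp [hSnd, hβ]
    rw [wronskianQuotient, if_pos hβ, hfst, hsnd]
  · rw [wronskianQuotient, if_neg hβ, wronskian_h_div w (N + 1) β β z hβ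
      (differentiableAt_hFst hw N β hz) (differentiableAt_hSnd hw N β hz)]

theorem mul_eval_derivative_paraOP :
    z * (derivative (paraOP (weightMeasure w) (N + 1) β)).eval z
      = hFst w (N + 1) β z * (paraOP (weightMeasure w) (N + 1) β).eval z
        + h w (N + 1) β β z * (reversedOP (weightMeasure w) N).eval z := by
  have hΦ := mul_eval_derivative_monicOP hw N hz
  have hΨ := eval_derivative_reversedOP hw N hz
  simp only [paraOP_succ, derivative_sub, derivative_mul, derivative_X, derivative_C, eval_sub,
    eval_add, eval_mul, eval_X, eval_C, one_mul, zero_mul, zero_add, h, hFst, hSnd,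
    Nat.add_sub_cancel]
  push_cast at hΨ ⊢
  linear_combination z * hΦ - z * starRingEnd ℂ β * hΨ

theorem eval_derivative_reversedOP_eq_add_paraOP (hz0 : z ≠ 0) :
    (derivative (reversedOP (weightMeasure w) N)).eval z
      = ((N + 1 : ℕ) * verblunsky (weightMeasure w) N - D w (N + 1) z) / z
          * (paraOP (weightMeasure w) (N + 1) β).eval z
        + (starRingEnd ℂ β * (((N + 1 : ℕ) * verblunsky (weightMeasure w) N - D w (N + 1) z) / z)
          - G w (N + 1) z) * (reversedOP (weightMeasure w) N).eval z := by
  rw [eval_derivative_reversedOP hw N hz]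
  field_simp
  linear_combination ((N + 1 : ℕ) * verblunsky (weightMeasure w) N - D w (N + 1) z)
    * mul_eval_monicOP (weightMeasure w) N β z

theorem eval_derivative_derivative_paraOP (hz0 : z ≠ 0) (hh : h w (N + 1) β β z ≠ 0) :
    (derivative (derivative (paraOP (weightMeasure w) (N + 1) β))).eval z
      = -coeffOne w (N + 1) β z * (derivative (paraOP (weightMeasure w) (N + 1) β)).eval z
        - coeffZero w (N + 1) β z * (paraOP (weightMeasure w) (N + 1) β).eval z := by
  have hfst := (differentiableAt_hFst hw N β hz).hasDerivAt
  have hh' := hasDerivAt_h hw N β hz β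
  have hy := (paraOP (weightMeasure w) (N + 1) β).hasDerivAt z
  have hy' := (derivative (paraOP (weightMeasure w) (N + 1) β)).hasDerivAt z
  have hu := ((reversedOP (weightMeasure w) N).hasDerivAt z).congr_deriv
    (eval_derivative_reversedOP_eq_add_paraOP hw N β hz hz0)
  have hsys : (fun s => (derivative (paraOP (weightMeasure w) (N + 1) β)).eval s) =ᶠ[𝓝 z] fun s =>
      hFst w (N + 1) β s / s * (paraOP (weightMeasure w) (N + 1) β).eval s
        + h w (N + 1) β β s / s * (reversedOP (weightMeasure w) N).eval s := by
    filter_upwards [continuous_norm.continuousAt.eventually_ne hz,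
      continuousAt_id.eventually_ne hz0] with s hs (hs0 : s ≠ 0)
    field_simp
    rw [mul_comm, mul_eval_derivative_paraOP hw N β hs]
  rw [second_deriv_eq_of_first_order_system hy hy' hu hsys
    (hfst.fun_div (hasDerivAt_id' z) hz0) (hh'.fun_div (hasDerivAt_id' z) hz0)
    (div_ne_zero hh hz0)]
  congr 2
  · rw [coeffOne, hh'.deriv, hFst, Nat.add_sub_cancel]
    field_simp
    ring
  · rw [coeffZero, wronskianQuotient_eq_wronskian hw N β hz, wronskian, Nat.add_sub_cancel]
    have hdet := det_firstOrderSystem w N β z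
    have hwronskian : hFst w (N + 1) β z
          * (starRingEnd ℂ β * deriv (hFst w (N + 1) β) z - deriv (hSnd w (N + 1) β) z)
          - deriv (hFst w (N + 1) β) z * h w (N + 1) β β z
        = hSnd w (N + 1) β z * deriv (hFst w (N + 1) β) z
          - hFst w (N + 1) β z * deriv (hSnd w (N + 1) β) z := by
      rw [h]
      ring
    field_simp
    linear_combination h w (N + 1) β β z * hdet + z * hwronskian

theorem paraOP_equation (hz0 : z ≠ 0) (hh : h w (N + 1) β β z ≠ 0) :
    (paraOP (weightMeasure w) (N + 1) β).derivative.derivative.eval z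
      + coeffOne w (N + 1) β z * (paraOP (weightMeasure w) (N + 1) β).derivative.eval z
      + coeffZero w (N + 1) β z * (paraOP (weightMeasure w) (N + 1) β).eval z = 0 := by
  rw [eval_derivative_derivative_paraOP hw N β hz hz0 hh]
  ring

end SecondOrderEquation

section Continuation

variable {U : Set ℂ} {l : Filter ℂ}

theorem eventually_eventually_nhds_of_isDomainAt (hU : IsDomainAt U l) {p : ℂ → Prop}
    (hp : ∀ᶠ z in l, p z) : ∀ᶠ z in l, ∀ᶠ s in 𝓝 z, p s := by
  obtain ⟨-, -, ⟨-, rfl⟩ | ⟨-, rfl⟩⟩ := hU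
  · filter_upwards [eventually_eventually_nhdsWithin.2 hp, self_mem_nhdsWithin] with z hz hz0
    rwa [isOpen_compl_singleton.nhdsWithin_eq hz0] at hz
  · obtain ⟨R, -, hR⟩ := hasBasis_cobounded_norm.eventually_iff.1 hp
    filter_upwards [tendsto_norm_cobounded_atTop.eventually_gt_atTop R] with z hz
    filter_upwards [continuous_norm.continuousAt.eventually_const_lt hz] with s hs
    exact hR (le_of_lt hs)

theorem eventually_mem_and_ne_zero_and_norm_ne_one_of_isDomainAt (hU : IsDomainAt U l) :
    ∀ᶠ z in l, z ∈ U ∧ z ≠ 0 ∧ ‖z‖ ≠ 1 := by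
  obtain ⟨ho, -, ⟨h0, rfl⟩ | ⟨hb, rfl⟩⟩ := hU
  · have hnorm : ∀ᶠ z : ℂ in 𝓝 0, ‖z‖ ≠ 1 :=
      continuous_norm.continuousAt.eventually_ne (by simp)
    filter_upwards [nhdsWithin_le_nhds (ho.mem_nhds h0), self_mem_nhdsWithin,
      nhdsWithin_le_nhds hnorm] with z hz hz0 hz1
    exact ⟨hz, hz0, hz1⟩
  · filter_upwards [hb, tendsto_norm_cobounded_atTop.eventually_gt_atTop 1] with z hz hz1
    exact ⟨hz, norm_pos_iff.1 (one_pos.trans hz1), hz1.ne'⟩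

theorem second_order_equation_of_meromorphicOn {𝕜 : Type*} [NontriviallyNormedField 𝕜]
    {U : Set 𝕜} {P Q : 𝕜 → 𝕜} {z₀ z : 𝕜} (hU : IsPreconnected U) (hP : MeromorphicOn P U)
    (hQ : MeromorphicOn Q U) (y : 𝕜[X]) (hz₀ : z₀ ∈ U)
    (hy : ∀ᶠ s in 𝓝[≠] z₀,
      y.derivative.derivative.eval s + P s * y.derivative.eval s + Q s * y.eval s = 0)
    (hz : z ∈ U) (hPz : ContinuousAt P z) (hQz : ContinuousAt Q z) :
    y.derivative.derivative.eval z + P z * y.derivative.eval z + Q z * y.eval z = 0 := by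
  have hmer : ∀ p : 𝕜[X], MeromorphicOn (fun s => p.eval s) U := fun p s _ =>
    (analyticAt_id.aeval_polynomial p).meromorphicAt
  exact eq_zero_of_meromorphicOn_of_eventuallyEq_zero hU
    (((hmer _).add (hP.mul (hmer _))).add (hQ.mul (hmer _))) hz₀ hy hz
    ((y.derivative.derivative.continuousAt.add (hPz.mul y.derivative.continuousAt)).add
      (hQz.mul y.continuousAt))

theorem exists_mem_eventually_paraOP_equation {w : ℝ → ℝ} (hw : IsWeight w) (N : ℕ) (β : ℂ)
    (hU : IsDomainAt U l) (hh : ∃ᶠ z in l, h w (N + 1) β β z ≠ 0) {P Q : ℂ → ℂ}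
    (hP : P =ᶠ[l] coeffOne w (N + 1) β) (hQ : Q =ᶠ[l] coeffZero w (N + 1) β) :
    ∃ z ∈ U, ∀ᶠ s in 𝓝 z, (paraOP (weightMeasure w) (N + 1) β).derivative.derivative.eval s
      + P s * (paraOP (weightMeasure w) (N + 1) β).derivative.eval s
      + Q s * (paraOP (weightMeasure w) (N + 1) β).eval s = 0 := by
  have hev := eventually_mem_and_ne_zero_and_norm_ne_one_of_isDomainAt hU
  have hloc := eventually_eventually_nhds_of_isDomainAt hU ((hP.and hQ).and hev)
  obtain ⟨z, hhz, hz, hzU, -, hz1⟩ := (hh.and_eventually (hloc.and hev)).exists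
  refine ⟨z, hzU, ?_⟩
  filter_upwards [hz, (hasDerivAt_h hw N β hz1 β).continuousAt.eventually_ne hhz]
  rintro s ⟨⟨hPs, hQs⟩, -, hs0, hs1⟩ hhs
  rw [hPs, hQs, paraOP_equation hw N β hs1 hs0 hhs]

end Continuation

end OPUC

end

theorem mainTheorem1_general (w : ℝ → ℝ) (hw : OPUC.IsWeight w) (n : ℕ) (hn : 1 ≤ n) (β : ℂ) :
    (∀ z : ℂ, ‖z‖ ≠ 1 → z ≠ 0 → OPUC.h w n β β z ≠ 0 →
      0 = (OPUC.paraOP (OPUC.weightMeasure w) n β).derivative.derivative.eval z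
        + OPUC.coeffOne w n β z
          * (OPUC.paraOP (OPUC.weightMeasure w) n β).derivative.eval z
        + OPUC.coeffZero w n β z
          * (OPUC.paraOP (OPUC.weightMeasure w) n β).eval z) ∧
    (∀ (U : Set ℂ) (l : Filter ℂ), OPUC.IsDomainAt U l →
      (∃ᶠ z in l, OPUC.h w n β β z ≠ 0) →
      ∀ P Q : ℂ → ℂ, MeromorphicOn P U → MeromorphicOn Q U →
        P =ᶠ[l] OPUC.coeffOne w n β → Q =ᶠ[l] OPUC.coeffZero w n β →
        ∀ z ∈ U, AnalyticAt ℂ P z → AnalyticAt ℂ Q z →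
          0 = (OPUC.paraOP (OPUC.weightMeasure w) n β).derivative.derivative.eval z
            + P z * (OPUC.paraOP (OPUC.weightMeasure w) n β).derivative.eval z
            + Q z * (OPUC.paraOP (OPUC.weightMeasure w) n β).eval z) := by
  obtain ⟨N, rfl⟩ : ∃ N, n = N + 1 := ⟨n - 1, by omega⟩
  refine ⟨fun z hz hz0 hh => (OPUC.paraOP_equation hw N β hz hz0 hh).symm, ?_⟩
  intro U l hU hh P Q hP hQ hPl hQl z hz hPz hQz
  obtain ⟨z₀, hz₀, hloc⟩ := OPUC.exists_mem_eventually_paraOP_equation hw N β hU hh hPl hQl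
  exact (OPUC.second_order_equation_of_meromorphicOn hU.2.1.isPreconnected hP hQ _ hz₀
    (hloc.filter_mono nhdsWithin_le_nhds) hz hPz.continuousAt hQz.continuousAt).symm

theorem mainTheorem1 (w : ℝ → ℝ)
    (hw_cont : ContinuousOn w (Set.Icc 0 (2 * Real.pi)))
    (hw_per : w 0 = w (2 * Real.pi))
    (hw_nonneg : ∀ θ ∈ Set.Icc 0 (2 * Real.pi), 0 ≤ w θ)
    (hw_diff : ∀ θ ∈ Set.Ioo 0 (2 * Real.pi), DifferentiableAt ℝ w θ)
    (hw_int : IntegrableOn (deriv w) (Set.Ioo 0 (2 * Real.pi)))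
    (hw_prob : IsProbabilityMeasure (OPUC.weightMeasure w))
    (n : ℕ) (hn : 1 ≤ n) (β : ℂ) :
    -- the equation holds wherever the integrals and the quotients make sense
    (∀ z : ℂ, ‖z‖ ≠ 1 → z ≠ 0 → OPUC.h w n β β z ≠ 0 →
      0 = (OPUC.paraOP (OPUC.weightMeasure w) n β).derivative.derivative.eval z
        + OPUC.coeffOne w n β z
          * (OPUC.paraOP (OPUC.weightMeasure w) n β).derivative.eval z
        + OPUC.coeffZero w n β z
          * (OPUC.paraOP (OPUC.weightMeasure w) n β).eval z) ∧
    -- and it persists on every domain to which the coefficients extend meromorphically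
    -- from a neighbourhood of zero or of infinity
    (∀ (U : Set ℂ) (l : Filter ℂ), OPUC.IsDomainAt U l →
      (∃ᶠ z in l, OPUC.h w n β β z ≠ 0) →
      ∀ P Q : ℂ → ℂ, MeromorphicOn P U → MeromorphicOn Q U →
        P =ᶠ[l] OPUC.coeffOne w n β → Q =ᶠ[l] OPUC.coeffZero w n β →
        ∀ z ∈ U, AnalyticAt ℂ P z → AnalyticAt ℂ Q z →
          0 = (OPUC.paraOP (OPUC.weightMeasure w) n β).derivative.derivative.eval z
            + P z * (OPUC.paraOP (OPUC.weightMeasure w) n β).derivative.eval z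
            + Q z * (OPUC.paraOP (OPUC.weightMeasure w) n β).eval z) := by
  exact mainTheorem1_general w ⟨OPUC.absolutelyContinuousOnInterval_of_integrableOn_deriv
    Real.two_pi_pos.le hw_cont hw_diff hw_int, hw_per, hw_nonneg, IsProbabilityMeasure.ne_zero _⟩
    n hn β
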